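/- All processes are indexed by $t\in\mathbb R$, and $\stackrel{\mathcal L}{=}$ denotes equality of all finite-dimensional distributions. For a real $n\times n$ matrix $H$ and $c>0$ put $c^H=\exp(\log(c)H)$. An $\mathbb R^n$-valued process $X$ is *operator self-similar with exponent $H$* if it is proper (for each $t\neq 0$, the law of $X(t)$ is not contained in a proper subspace of $\mathbb R^n$), continuous in law at every $t$, and $\{X(ct)\}\stackrel{\mathcal L}{=}\{c^HX(t)\}$ for all $c>0$. It is an *operator fractional Brownian motion (OFBM) with exponent $H$* if it is moreover Gaussian with stationary increments (the law of $\{X(t+h)-X(h)\}_t$ does not depend on $h\in\mathbb R$). An *operator Brownian motion (OBM)* is a proper Gaussian operator self-similar process (for some exponent) with stationary and independent increments and $X(0)=0$ a.s. **Proposition.** Let $\{B_H(t)\}_{t\in\mathbb R}$ be an OFBM in $\mathbb R^n$ with exponent $H=\tfrac12 I$. (a) Let $M,N\in M(n,\mathbb R)$ be parameters of a time domain representation $$\{B_H(t)\}\stackrel{\mathcal L}{=}\Big\{\int_{\mathbb R}\Big((\operatorname{sign}(t-u)-\operatorname{sign}(-u))\,M+\log\Big(\frac{|t-u|}{|u|}\Big)N\Big)\,B(du)\Big\},$$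 where $B$ is a vector of $n$ independent standard Brownian motions on $\mathbb R$. Then $B_H$ is an OBM if and only if (i) $MN^*=NM^*$. (b) Let $A=A_1+iA_2$, with $A_1,A_2\in M(n,\mathbb R)$, be the parameter of a spectral domain representation $$\{B_H(t)\}\stackrel{\mathcal L}{=}\Big\{\int_{\mathbb R}\frac{e^{itx}-1}{ix}\big(1_{\{x>0\}}A+1_{\{x<0\}}\overline A\big)\,\widetilde B(dx)\Big\},$$ where $\widetilde B=\widetilde B_1+i\widetilde B_2$ is a complex-valued multivariate Brownian motion with $\widetilde B_1,\widetilde B_2$ independent with independent components, whose induced measures satisfy $\widetilde B_1(-dx)=\widetilde B_1(dx)$, $\widetilde B_2(-dx)=-\widetilde B_2(dx)$ and $E\widetilde B_1(dx)\widetilde B_1(dx)^*=E\widetilde B_2(dx)\widetilde B_2(dx)^*=\tfrac12 I\,dx$ (so $E\widetilde B(dx)\widetilde B(dx)^*=I\,dx$). Then $B_H$ is an OBM if and only if (ii) $A_2A_1^*=A_1A_2^*$. (c) For any such $M,N$ and any such $A$, conditions (i) and (ii) are equivalent. Here $*$ denotes transposition of real matrices and conjugate transposition of complex ones. -/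

import Mathlib

open MeasureTheory ProbabilityTheory Filter
open scoped NNReal Topology Matrix

universe u v w

noncomputable section

namespace OFBM

/-! ### Operator self-similar processes -/

/-- `n × n` matrices over `𝕜`. -/
abbrev Mat (n : ℕ) (𝕜 : Type) : Type := Matrix (Fin n) (Fin n) 𝕜

/-- The space `𝕜ⁿ` with its Euclidean norm. -/
abbrev Vec (n : ℕ) (𝕜 : Type) : Type := EuclideanSpace 𝕜 (Fin n)

/-- A matrix acting on a vector of `𝕜ⁿ`. -/
def act {n : ℕ} {𝕜 : Type} [RCLike 𝕜] (A : Mat n 𝕜) (v : Vec n 𝕜) : Vec n 𝕜 :=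
  WithLp.toLp 2 (A *ᵥ v.ofLp)

/-- `z ^ D = exp (log z • D)` for `z > 0`, with the convention that it is the zero matrix at
`z = 0`. (It is only used for `z ≥ 0`.) -/
def matPow {n : ℕ} (z : ℝ) (D : Mat n ℝ) : Mat n ℝ :=
  if z = 0 then 0 else NormedSpace.exp (Real.log z • D)

/-- Equality of all finite-dimensional distributions of two processes indexed by `ℝ`, possibly
defined on different probability spaces. -/
def SameFDD {Ω Ω' E : Type*} [MeasurableSpace Ω] [MeasurableSpace Ω'] [MeasurableSpace E]
    (X : ℝ → Ω → E) (P : Measure Ω) (Y : ℝ → Ω' → E) (P' : Measure Ω') : Prop :=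
  ∀ I : Finset ℝ, IdentDistrib (fun ω ↦ I.restrict (X · ω)) (fun ω ↦ I.restrict (Y · ω)) P P'

section Processes

variable {n : ℕ} {Ω : Type*} [MeasurableSpace Ω]

/-- The process is proper: for `t ≠ 0`, the law of `X t` is not carried by a proper linear
subspace. -/
def IsProper (X : ℝ → Ω → Vec n ℝ) (P : Measure Ω) : Prop :=
  ∀ t : ℝ, t ≠ 0 → ∀ W : Submodule ℝ (Vec n ℝ), W ≠ ⊤ → ¬ ∀ᵐ ω ∂P, X t ω ∈ W

/-- The process is proper, continuous in law, and operator self-similar with exponent `H`: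
`{X (c t)}` and `{c ^ H X t}` have the same finite-dimensional distributions for every `c > 0`. -/
structure IsOperatorSelfSimilar (X : ℝ → Ω → Vec n ℝ) (H : Mat n ℝ) (P : Measure Ω)
    [IsProbabilityMeasure P] : Prop where
  proper : IsProper X P
  continuous_in_law : ∀ t : ℝ, TendstoInDistribution X (𝓝 t) (X t) (fun _ ↦ P) P
  scaling : ∀ c : ℝ, 0 < c →
    SameFDD (fun t ω ↦ X (c * t) ω) P (fun t ω ↦ act (matPow c H) (X t ω)) P

/-- The law of the process `{X (t + h) - X h}` does not depend on the shift `h`. -/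
def HasStationaryIncrements (X : ℝ → Ω → Vec n ℝ) (P : Measure Ω) : Prop :=
  ∀ h : ℝ, SameFDD (fun t ω ↦ X (t + h) ω - X h ω) P (fun t ω ↦ X t ω - X 0 ω) P

/-- `X` is an operator fractional Brownian motion with exponent `H`. -/
structure IsOFBM (X : ℝ → Ω → Vec n ℝ) (H : Mat n ℝ) (P : Measure Ω)
    [IsProbabilityMeasure P] : Prop where
  gaussian : IsGaussianProcess X P
  selfSimilar : IsOperatorSelfSimilar X H P
  stationary : HasStationaryIncrements X P

/-- `X` is an operator Brownian motion: a proper Gaussian operator self-similar process (with some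
exponent) with stationary and independent increments that starts at `0`. -/
structure IsOBM (X : ℝ → Ω → Vec n ℝ) (P : Measure Ω) [IsProbabilityMeasure P] : Prop where
  gaussian : IsGaussianProcess X P
  selfSimilar : ∃ H : Mat n ℝ, IsOperatorSelfSimilar X H P
  stationary : HasStationaryIncrements X P
  independent : HasIndepIncrements X P
  zero : ∀ᵐ ω ∂P, X 0 ω = 0

end Processes

/-! ### Integrals of deterministic matrix-valued kernels -/

/-- Data of a matrix-valued step function `∑ k, 1_(left k, right k] coeff k`. -/
structure StepFunction (n : ℕ) (𝕜 : Type) where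
  num : ℕ
  left : Fin num → ℝ
  right : Fin num → ℝ
  left_le_right : ∀ k, left k ≤ right k
  coeff : Fin num → Mat n 𝕜

namespace StepFunction

variable {n : ℕ} {𝕜 : Type} [RCLike 𝕜]

/-- The step function as a function on `ℝ`. -/
def toFun (φ : StepFunction n 𝕜) (u : ℝ) : Mat n 𝕜 :=
  ∑ k, (Set.Ioc (φ.left k) (φ.right k)).indicator (fun _ ↦ φ.coeff k) u

/-- The integral of the step function against the random measure `Z(du)` for which
`Z((a, b]) = Z b - Z a`. -/
def integral {Ω : Type*} (φ : StepFunction n 𝕜) (Z : ℝ → Ω → Vec n 𝕜) (ω : Ω) : Vec n 𝕜 :=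
  ∑ k, act (φ.coeff k) (Z (φ.right k) ω - Z (φ.left k) ω)

end StepFunction

/-- The random vector `Y` is the integral `∫ f(u) Z(du)` of the square-integrable kernel `f`: it is
the limit in `L²(P)` of the integrals of step functions converging to `f` in `L²(ℝ)`. -/
def IsStochasticIntegral {n : ℕ} {𝕜 : Type} [RCLike 𝕜] {Ω : Type*} [MeasurableSpace Ω]
    (Z : ℝ → Ω → Vec n 𝕜) (P : Measure Ω) (f : ℝ → Mat n 𝕜) (Y : Ω → Vec n 𝕜) : Prop :=
  (∀ i j, MemLp (fun u ↦ f u i j) 2 volume) ∧ MemLp Y 2 P ∧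
    ∃ φ : ℕ → StepFunction n 𝕜,
      (∀ i j, Tendsto (fun m ↦ eLpNorm (fun u ↦ (φ m).toFun u i j - f u i j) 2 volume)
        atTop (𝓝 0)) ∧
      Tendsto (fun m ↦ eLpNorm (fun ω ↦ (φ m).integral Z ω - Y ω) 2 P) atTop (𝓝 0)

/-! ### The driving noises -/

section Noise

variable {n : ℕ} {Ω : Type*} [MeasurableSpace Ω]

/-- Standard Brownian motion on `ℝ`: two independent standard Brownian motions on the half-lines,
glued at `0`. -/
structure IsTwoSidedBrownian (B : ℝ → Ω → ℝ) (P : Measure Ω) : Prop where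
  measurable : ∀ t, Measurable (B t)
  forward : IsBrownianReal (fun (t : ℝ≥0) ω ↦ B t ω) P
  backward : IsBrownianReal (fun (t : ℝ≥0) ω ↦ B (-t) ω) P
  indep : IndepFun (fun ω (t : ℝ≥0) ↦ B t ω) (fun ω (t : ℝ≥0) ↦ B (-t) ω) P

/-- A vector of `n` independent standard Brownian motions on `ℝ`; so `E B(du) B(du)* = du I`. -/
structure IsVectorBrownian (B : ℝ → Ω → Vec n ℝ) (P : Measure Ω) : Prop where
  brownian : ∀ i, IsTwoSidedBrownian (fun t ω ↦ B t ω i) P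
  indep : iIndepFun (fun i ω t ↦ B t ω i) P

/-- The complex vector process `B₁ + i B₂`. -/
def complexProcess (B₁ B₂ : ℝ → Ω → Vec n ℝ) (x : ℝ) (ω : Ω) : Vec n ℂ :=
  WithLp.toLp 2 fun i ↦ (B₁ x ω i : ℂ) + Complex.I * (B₂ x ω i : ℂ)

/-- The real and imaginary parts of a complex-valued multivariate Brownian motion
`B₁ + i B₂` on `ℝ` with `B₁(-dx) = B₁(dx)`, `B₂(-dx) = -B₂(dx)` for the induced measures, `B₁` and
`B₂` independent with independent components, and `E B₁(dx)B₁(dx)* = E B₂(dx)B₂(dx)* = (dx/2) I`,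
so that the induced measure of `B = B₁ + i B₂` is orthogonal with `E B(dx)B(dx)* = dx I`. -/
structure IsHermitianNoise (B₁ B₂ : ℝ → Ω → Vec n ℝ) (P : Measure Ω) : Prop where
  measurable₁ : ∀ x, Measurable (B₁ x)
  measurable₂ : ∀ x, Measurable (B₂ x)
  brownian₁ : ∀ i, IsBrownianReal (fun (x : ℝ≥0) ω ↦ √2 * B₁ x ω i) P
  brownian₂ : ∀ i, IsBrownianReal (fun (x : ℝ≥0) ω ↦ √2 * B₂ x ω i) P
  indep₁ : iIndepFun (fun i ω x ↦ B₁ x ω i) P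
  indep₂ : iIndepFun (fun i ω x ↦ B₂ x ω i) P
  indep : IndepFun (fun ω x ↦ B₁ x ω) (fun ω x ↦ B₂ x ω) P
  even₁ : ∀ a b : ℝ, ∀ᵐ ω ∂P, B₁ (-a) ω - B₁ (-b) ω = B₁ b ω - B₁ a ω
  odd₂ : ∀ a b : ℝ, ∀ᵐ ω ∂P, B₂ (-a) ω - B₂ (-b) ω = -(B₂ b ω - B₂ a ω)

end Noise

/-! ### Integral representations -/

/-- The kernel `(sign(t-u) - sign(-u)) M + log(|t-u| / |u|) N`. -/
def timeKernel {n : ℕ} (M N : Mat n ℝ) (t u : ℝ) : Mat n ℝ :=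
  (Real.sign (t - u) - Real.sign (-u)) • M + Real.log (|t - u| / |u|) • N

/-- The kernel `((e^{itx} - 1) / (ix)) (x₊^{-D} A + x₋^{-D} Ā)`, where `D = H - (1/2) I`. -/
def spectralKernel {n : ℕ} (H : Mat n ℝ) (A : Mat n ℂ) (t x : ℝ) : Mat n ℂ :=
  ((Complex.exp (Complex.I * t * x) - 1) / (Complex.I * x)) •
    ((matPow (max x 0) (-(H - (1 / 2 : ℝ) • (1 : Mat n ℝ)))).map Complex.ofReal * A +
      (matPow (max (-x) 0) (-(H - (1 / 2 : ℝ) • (1 : Mat n ℝ)))).map Complex.ofReal *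
        A.map (starRingEnd ℂ))

/-- A real vector seen as a complex one. -/
def toComplex {n : ℕ} (v : Vec n ℝ) : Vec n ℂ := WithLp.toLp 2 fun i ↦ (v i : ℂ)



/-- `{X t}` has the same finite-dimensional distributions as `{∫ timeKernel M N t u B(du)}`, where
`B` is a vector of independent standard Brownian motions. -/
def HasTimeRepresentation {n : ℕ} {Ω : Type u} [MeasurableSpace Ω]
    (X : ℝ → Ω → Vec n ℝ) (P : Measure Ω) (M N : Mat n ℝ) : Prop :=
  ∃ (Ω' : Type v) (_ : MeasurableSpace Ω') (P' : Measure Ω') (_ : IsProbabilityMeasure P')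
    (B Y : ℝ → Ω' → Vec n ℝ), IsVectorBrownian B P' ∧
      (∀ t, IsStochasticIntegral B P' (timeKernel M N t) (Y t)) ∧ SameFDD X P Y P'

/-- `{X t}` has the same finite-dimensional distributions as `{∫ spectralKernel H A t x B(dx)}`,
where `B = B₁ + i B₂` is a complex-valued multivariate Brownian motion as in
`IsHermitianNoise`. -/
def HasSpectralRepresentation {n : ℕ} {Ω : Type u} [MeasurableSpace Ω]
    (X : ℝ → Ω → Vec n ℝ) (P : Measure Ω) (H : Mat n ℝ) (A : Mat n ℂ) : Prop :=
  ∃ (Ω' : Type v) (_ : MeasurableSpace Ω') (P' : Measure Ω') (_ : IsProbabilityMeasure P')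
    (B₁ B₂ : ℝ → Ω' → Vec n ℝ) (Y : ℝ → Ω' → Vec n ℂ), IsHermitianNoise B₁ B₂ P' ∧
      (∀ t, IsStochasticIntegral (complexProcess B₁ B₂) P' (spectralKernel H A t) (Y t)) ∧
      SameFDD (fun t ω ↦ toComplex (X t ω)) P Y P'

end OFBM

end

/-! Write Γ(s,t) = E X(s)X(t)*. Scaling by √c forces X(0) = 0 and, with stationary increments, mean
zero and E(X(t)-X(s))(X(t)-X(s))* = (t-s)Γ(1,1) for s ≤ t. Polarization then expresses Γ(s,t) +
Γ(t,s) through Γ(s,s), Γ(t,t) and Γ(1,1), while the difference Γ(s,t) - Γ(t,s) stays free. If the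
difference vanishes everywhere, disjoint increments are uncorrelated, hence independent because the
process is Gaussian. Conversely, independent increments give Γ(1,2) = Γ(1,1), which is a symmetric
matrix, so the difference vanishes at (1,2).

In either representation the Itô isometry turns the difference into a scalar c(s,t) times a fixed
matrix, MN* - NM* or A₂A₁* - A₁A₂*. So X is an OBM exactly when that matrix is zero, provided c(1,2)
≠ 0 (`IsOFBM.isOBM_iff`). In the time domain c(1,2) = 8 log 2 (`timePairing_one_two`). In the
spectral domain it is 8 ∫₀^∞ (1 - cos x)²/x³ dx > 0 (`spectralPairing_one_two_pos`). Both matrix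
conditions characterize the same property of X, so they are equivalent. -/

noncomputable section

/-! ### Second moments and independence of increments for exponent 1/2 -/

namespace OFBM

variable {n : ℕ} {Ω : Type*} [MeasurableSpace Ω] {P : Measure Ω}

/-- The entries `E X(s)ᵢ X(t)ⱼ` of the second moments of a vector process. -/
def secondMoment (X : ℝ → Ω → Vec n ℝ) (P : Measure Ω) (i j : Fin n) (s t : ℝ) : ℝ :=
  ∫ ω, X s ω i * X t ω j ∂P

lemma SameFDD.identDistrib_eval {Ω' E : Type*} [MeasurableSpace Ω'] [MeasurableSpace E]
    {P' : Measure Ω'} {X : ℝ → Ω → E} {Y : ℝ → Ω' → E} (h : SameFDD X P Y P') (t : ℝ) :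
    IdentDistrib (X t) (Y t) P P' :=
  (h {t}).comp (measurable_pi_apply (⟨t, by simp⟩ : ({t} : Finset ℝ)))

lemma SameFDD.identDistrib_prodMk {Ω' E : Type*} [MeasurableSpace Ω'] [MeasurableSpace E]
    {P' : Measure Ω'} {X : ℝ → Ω → E} {Y : ℝ → Ω' → E} (h : SameFDD X P Y P') (s t : ℝ) :
    IdentDistrib (fun ω ↦ (X s ω, X t ω)) (fun ω ↦ (Y s ω, Y t ω)) P P' :=
  (h {s, t}).comp ((measurable_pi_apply (⟨s, by simp⟩ : ({s, t} : Finset ℝ))).prodMk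
    (measurable_pi_apply (⟨t, by simp⟩ : ({s, t} : Finset ℝ))))

lemma SameFDD.secondMoment_eq {Ω' : Type*} [MeasurableSpace Ω'] {P' : Measure Ω'}
    {X : ℝ → Ω → Vec n ℝ} {Y : ℝ → Ω' → Vec n ℝ} (h : SameFDD X P Y P') (i j : Fin n) (s t : ℝ) :
    secondMoment X P i j s t = secondMoment Y P' i j s t :=
  ((h.identDistrib_prodMk s t).comp (u := fun p : Vec n ℝ × Vec n ℝ ↦ p.1 i * p.2 j)
    (by fun_prop)).integral_eq

lemma SameFDD.integral_apply_eq {Ω' : Type*} [MeasurableSpace Ω'] {P' : Measure Ω'}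
    {X : ℝ → Ω → Vec n ℝ} {Y : ℝ → Ω' → Vec n ℝ} (h : SameFDD X P Y P') (i : Fin n) (t : ℝ) :
    ∫ ω, X t ω i ∂P = ∫ ω, Y t ω i ∂P' :=
  ((h.identDistrib_eval t).comp (u := fun p : Vec n ℝ ↦ p i) (by fun_prop)).integral_eq

lemma matPow_half {c : ℝ} (hc : 0 < c) :
    matPow c ((1 / 2 : ℝ) • (1 : Mat n ℝ)) = √c • (1 : Mat n ℝ) := by
  rw [matPow, if_neg hc.ne', smul_smul, Matrix.smul_one_eq_diagonal, Matrix.exp_diagonal,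
    Matrix.smul_one_eq_diagonal]
  congr 1
  ext i
  rw [Pi.coe_exp, ← Real.exp_eq_exp_ℝ, mul_one_div, Real.exp_half, Real.exp_log hc]

lemma matPow_zero_exponent {z : ℝ} : matPow z (0 : Mat n ℝ) = if z = 0 then 0 else 1 := by
  simp [matPow]

lemma smul_one_act (c : ℝ) (v : Vec n ℝ) (i : Fin n) : act (c • (1 : Mat n ℝ)) v i = c * v i := by
  simp [act, Matrix.smul_mulVec]

lemma memLp_two_apply {X : ℝ → Ω → Vec n ℝ} (hX : IsGaussianProcess X P) (t : ℝ) (i : Fin n) :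
    MemLp (fun ω ↦ X t ω i) 2 P :=
  ((hX.hasGaussianLaw_eval t).map (EuclideanSpace.proj (𝕜 := ℝ) i)).memLp_two

lemma memLp_two_sub_apply {X : ℝ → Ω → Vec n ℝ} (hX : IsGaussianProcess X P) (s t : ℝ)
    (i : Fin n) : MemLp (fun ω ↦ (X t ω - X s ω) i) 2 P :=
  (memLp_two_apply hX t i).sub (memLp_two_apply hX s i)

namespace IsOFBM

variable [IsProbabilityMeasure P] {X : ℝ → Ω → Vec n ℝ}
  (hX : IsOFBM X ((1 / 2 : ℝ) • (1 : Mat n ℝ)) P)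

include hX

lemma secondMoment_mul (i j : Fin n) {c : ℝ} (hc : 0 < c) (s t : ℝ) :
    secondMoment X P i j (c * s) (c * t) = c * secondMoment X P i j s t := by
  have h := (hX.selfSimilar.scaling c hc).secondMoment_eq i j s t
  simp only [secondMoment, matPow_half hc, smul_one_act] at h ⊢
  rw [h, ← integral_const_mul]
  congr 1 with ω
  linear_combination (X s ω i * X t ω j) * Real.mul_self_sqrt hc.le

/-- Time 0 is fixed by scaling, so c = 2 gives E X(0)ᵢ² = 2 E X(0)ᵢ². -/
lemma apply_zero_ae_eq_zero : ∀ᵐ ω ∂P, X 0 ω = 0 := by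
  have h (i : Fin n) : ∀ᵐ ω ∂P, X 0 ω i = 0 := by
    have h0 : secondMoment X P i i 0 0 = 0 := by
      have := hX.secondMoment_mul i i two_pos 0 0
      rw [mul_zero] at this
      linarith
    have h1 := (integral_eq_zero_iff_of_nonneg (fun ω ↦ mul_self_nonneg (X 0 ω i))
      ((memLp_two_apply hX.gaussian 0 i).integrable_mul (memLp_two_apply hX.gaussian 0 i))).1 h0
    filter_upwards [h1] with ω hω using mul_self_eq_zero.1 hω
  filter_upwards [ae_all_iff.2 h] with ω hω
  ext i
  simpa using hω i

lemma integral_increment (i : Fin n) (h t : ℝ) :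
    ∫ ω, (X (t + h) ω - X h ω) i ∂P = ∫ ω, X t ω i ∂P := by
  rw [(hX.stationary h).integral_apply_eq i t]
  refine integral_congr_ae ?_
  filter_upwards [hX.apply_zero_ae_eq_zero] with ω hω
  simp [hω]

/-- Stationary increments make the mean additive in time, while scaling makes it grow like √c. At c
= 4 these give m(4t) = 4m(t) and m(4t) = 2m(t). -/
lemma integral_apply (i : Fin n) (t : ℝ) : ∫ ω, X t ω i ∂P = 0 := by
  have hi (t) : Integrable (fun ω ↦ X t ω i) P :=
    (memLp_two_apply hX.gaussian t i).integrable one_le_two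
  have h4 : ∫ ω, X (4 * t) ω i ∂P = 2 * ∫ ω, X t ω i ∂P := by
    rw [(hX.selfSimilar.scaling 4 (by norm_num)).integral_apply_eq i t]
    simp only [matPow_half (show (0 : ℝ) < 4 by norm_num), smul_one_act]
    rw [integral_const_mul, show √(4 : ℝ) = 2 by
      rw [show (4 : ℝ) = 2 ^ 2 by norm_num, Real.sqrt_sq zero_le_two]]
  have hadd (h t) : ∫ ω, X (t + h) ω i ∂P = ∫ ω, X t ω i ∂P + ∫ ω, X h ω i ∂P := by
    have := hX.integral_increment i h t
    simp only [PiLp.sub_apply] at this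
    rw [integral_sub (hi _) (hi _)] at this
    linarith
  have h1 := hadd t t
  have h2 := hadd (t + t) (t + t)
  rw [show t + t + (t + t) = 4 * t by ring] at h2
  linarith

lemma integral_increment_mul (i j : Fin n) {s t : ℝ} (hst : s ≤ t) :
    ∫ ω, (X t ω - X s ω) i * (X t ω - X s ω) j ∂P = (t - s) * secondMoment X P i j 1 1 := by
  have h := (hX.stationary s).secondMoment_eq i j (t - s) (t - s)
  simp only [secondMoment, sub_add_cancel] at h
  rw [h]
  have h0 : ∫ ω, (X (t - s) ω - X 0 ω) i * (X (t - s) ω - X 0 ω) j ∂P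
      = secondMoment X P i j (t - s) (t - s) := by
    refine integral_congr_ae ?_
    filter_upwards [hX.apply_zero_ae_eq_zero] with ω hω
    simp [hω]
  rw [h0]
  -- Scaling needs a positive factor t - s, so equality is treated apart.
  rcases hst.eq_or_lt with rfl | hlt
  · rw [sub_self, zero_mul]
    refine (integral_congr_ae ?_).trans (integral_zero Ω ℝ)
    filter_upwards [hX.apply_zero_ae_eq_zero] with ω hω
    simp [hω]
  · simpa using hX.secondMoment_mul i j (sub_pos.2 hlt) 1 1

/-- Polarization of the increment's second moment. Only the sum over the swap of s and t is
determined; for matrix-valued moments this leaves the antisymmetric part undetermined. -/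
lemma secondMoment_add_swap (i j : Fin n) {s t : ℝ} (hst : s ≤ t) :
    secondMoment X P i j s t + secondMoment X P i j t s =
      secondMoment X P i j s s + secondMoment X P i j t t
        - (t - s) * secondMoment X P i j 1 1 := by
  have hi (s t : ℝ) : Integrable (fun ω ↦ X s ω i * X t ω j) P :=
    (memLp_two_apply hX.gaussian s i).integrable_mul (memLp_two_apply hX.gaussian t j)
  rw [← hX.integral_increment_mul i j hst]
  simp only [secondMoment]
  have h := integral_sub ((hi s s).add (hi t t))
    ((memLp_two_sub_apply hX.gaussian s t i).integrable_mul
      (memLp_two_sub_apply hX.gaussian s t j))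
  simp only [Pi.add_apply, Pi.mul_apply] at h
  rw [← integral_add (hi _ _) (hi _ _), ← integral_add (hi _ _) (hi _ _), ← h]
  congr 1 with ω
  simp only [PiLp.sub_apply]
  ring

/-- Under symmetry, polarization determines each of the four moments in the expanded product. In
their alternating sum the diagonal moments cancel, and so do the terms linear in time. -/
lemma integral_increment_mul_increment (hsymm : ∀ i j s t,
      secondMoment X P i j s t = secondMoment X P i j t s)
    (i j : Fin n) {a b c d : ℝ} (hab : a ≤ b) (hbc : b ≤ c) (hcd : c ≤ d) :
    ∫ ω, (X b ω - X a ω) i * (X d ω - X c ω) j ∂P = 0 := by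
  have hi (s t : ℝ) : Integrable (fun ω ↦ X s ω i * X t ω j) P :=
    (memLp_two_apply hX.gaussian s i).integrable_mul (memLp_two_apply hX.gaussian t j)
  have h : ∫ ω, (X b ω - X a ω) i * (X d ω - X c ω) j ∂P =
      (secondMoment X P i j b d - secondMoment X P i j a d)
        - (secondMoment X P i j b c - secondMoment X P i j a c) := by
    simp only [secondMoment]
    have h := integral_sub ((hi b d).sub (hi a d)) ((hi b c).sub (hi a c))
    simp only [Pi.sub_apply] at h
    rw [← integral_sub (hi _ _) (hi _ _), ← integral_sub (hi _ _) (hi _ _), ← h]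
    congr 1 with ω
    simp only [PiLp.sub_apply]
    ring
  rw [h]
  linarith [hX.secondMoment_add_swap i j (hbc.trans hcd), hX.secondMoment_add_swap i j hbc,
    hX.secondMoment_add_swap i j (hab.trans hbc),
    hX.secondMoment_add_swap i j ((hab.trans hbc).trans hcd),
    hsymm i j b d, hsymm i j a d, hsymm i j b c, hsymm i j a c]

/-- The increments are jointly Gaussian, so vanishing covariances between coordinates of different
increments suffice. -/
lemma hasIndepIncrements (hsymm : ∀ i j s t,
    secondMoment X P i j s t = secondMoment X P i j t s) : HasIndepIncrements X P := by
  intro m t ht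
  have hG := hX.gaussian.hasGaussianLaw_increments (t := t)
  have hzero (k : Fin m) (i : Fin n) :
      ∫ ω, (X (t k.succ) ω - X (t k.castSucc) ω) i ∂P = 0 := by
    have := hX.integral_increment i (t k.castSucc) (t k.succ - t k.castSucc)
    rwa [sub_add_cancel, hX.integral_apply] at this
  have key : iIndepFun (fun (k : Fin m) ω (i : Fin n) ↦
      (X (t k.succ) ω - X (t k.castSucc) ω) i) P := by
    refine HasGaussianLaw.iIndepFun_of_covariance_eval
      (X := fun (k : Fin m) (i : Fin n) ω ↦ (X (t k.succ) ω - X (t k.castSucc) ω) i) ?_ ?_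
    · exact hG.map_equiv (.piCongrRight (fun _ ↦ PiLp.continuousLinearEquiv 2 ℝ (fun _ ↦ ℝ)))
    · intro k l hkl i j
      simp only [covariance, hzero, sub_zero]
      rcases hkl.lt_or_gt with h | h
      · exact hX.integral_increment_mul_increment hsymm i j (ht k.castSucc_lt_succ.le)
          (ht (by simpa [Fin.le_def] using h)) (ht l.castSucc_lt_succ.le)
      · simp_rw [mul_comm ((X (t k.succ) _ - X (t k.castSucc) _) i)]
        exact hX.integral_increment_mul_increment hsymm j i (ht l.castSucc_lt_succ.le)
          (ht (by simpa [Fin.le_def] using h)) (ht k.castSucc_lt_succ.le)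
  exact key.comp (fun _ x ↦ WithLp.toLp 2 x) (fun _ ↦ by fun_prop)

/-- An OFBM with exponent `1/2` is an OBM as soon as its second moments are symmetric in time. -/
lemma isOBM_of_secondMoment_swap (hsymm : ∀ i j s t,
    secondMoment X P i j s t = secondMoment X P i j t s) : IsOBM X P where
  gaussian := hX.gaussian
  selfSimilar := ⟨_, hX.selfSimilar⟩
  stationary := hX.stationary
  independent := hX.hasIndepIncrements hsymm
  zero := hX.apply_zero_ae_eq_zero

/-- X(1) is independent of X(2) - X(1) and centred, so E X(1)ᵢX(2)ⱼ = E X(1)ᵢX(1)ⱼ, which is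
symmetric in i and j. -/
lemma secondMoment_one_two_swap (hB : IsOBM X P) (i j : Fin n) :
    secondMoment X P i j 1 2 = secondMoment X P i j 2 1 := by
  have hind := hB.independent.indepFun_eval_sub (r := 0) (s := 1) (t := 2) zero_le_one
    one_le_two hB.zero
  have hi (s t : ℝ) (i j : Fin n) : Integrable (fun ω ↦ X s ω i * X t ω j) P :=
    (memLp_two_apply hX.gaussian s i).integrable_mul (memLp_two_apply hX.gaussian t j)
  have key (i j : Fin n) : secondMoment X P i j 1 2 = secondMoment X P i j 1 1 := by
    have h := (hind.comp (φ := fun x : Vec n ℝ ↦ x i) (ψ := fun x : Vec n ℝ ↦ x j)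
      (by fun_prop) (by fun_prop)).integral_fun_mul_eq_mul_integral
      (memLp_two_apply hX.gaussian 1 i).aestronglyMeasurable
      (memLp_two_sub_apply hX.gaussian 1 2 j).aestronglyMeasurable
    simp only [Function.comp_apply, hX.integral_apply, zero_mul, Pi.sub_apply, PiLp.sub_apply,
      mul_sub] at h
    rw [integral_sub (hi _ _ _ _) (hi _ _ _ _)] at h
    exact sub_eq_zero.1 h
  rw [key i j, show secondMoment X P i j 2 1 = secondMoment X P j i 1 2 by
    simp only [secondMoment, mul_comm], key j i]
  simp only [secondMoment, mul_comm]

end IsOFBM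

end OFBM

end

/-! ### The Itô isometry for orthogonal noises -/

noncomputable section

namespace OFBM

variable {n : ℕ} {𝕜 : Type} [RCLike 𝕜] {Ω : Type*} [MeasurableSpace Ω] {P : Measure Ω}

lemma integrable_mul_star {α : Type*} [MeasurableSpace α] {μ : Measure α} {f g : α → 𝕜}
    (hf : MemLp f 2 μ) (hg : MemLp g 2 μ) : Integrable (fun x ↦ f x * star (g x)) μ :=
  hf.integrable_mul hg.star

/-- Continuity of the L² inner product; the arguments are exchanged because `inner` conjugates the
first one. -/
lemma tendsto_integral_mul_star {α : Type*} [MeasurableSpace α] {μ : Measure α}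
    {f g : ℕ → α → 𝕜} {F G : α → 𝕜} (hf : ∀ m, MemLp (f m) 2 μ) (hg : ∀ m, MemLp (g m) 2 μ)
    (hF : MemLp F 2 μ) (hG : MemLp G 2 μ)
    (hfF : Tendsto (fun m ↦ eLpNorm (fun x ↦ f m x - F x) 2 μ) atTop (𝓝 0))
    (hgG : Tendsto (fun m ↦ eLpNorm (fun x ↦ g m x - G x) 2 μ) atTop (𝓝 0)) :
    Tendsto (fun m ↦ ∫ x, f m x * star (g m x) ∂μ) atTop (𝓝 (∫ x, F x * star (G x) ∂μ)) := by
  have hinner {u v : α → 𝕜} (hu : MemLp u 2 μ) (hv : MemLp v 2 μ) :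
      ∫ x, u x * star (v x) ∂μ = inner 𝕜 (hv.toLp v) (hu.toLp u) := by
    rw [L2.inner_def]
    refine integral_congr_ae ?_
    filter_upwards [hu.coeFn_toLp, hv.coeFn_toLp] with x hxu hxv
    rw [hxu, hxv, RCLike.inner_apply]
    rfl
  simp_rw [hinner (hf _) (hg _), hinner hF hG]
  exact ((Lp.tendsto_Lp_iff_tendsto_eLpNorm'' g hg G hG).2 hgG).inner
    ((Lp.tendsto_Lp_iff_tendsto_eLpNorm'' f hf F hF).2 hfF)

/-- A random measure on `ℝ` with orthogonal components and `E Z(du) Z(du)* = du I`,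
described by the second moments of its distribution function. -/
structure IsOrthogonalNoise (Z : ℝ → Ω → Vec n 𝕜) (P : Measure Ω) : Prop where
  memLp : ∀ t k, MemLp (fun ω ↦ Z t ω k) 2 P
  integral_mul_star : ∀ s t k l, ∫ ω, Z s ω k * star (Z t ω l) ∂P =
    if k = l then (((|s| + |t| - |s - t|) / 2 : ℝ) : 𝕜) else 0

/-- The right side is the mixed second difference of (|s| + |t| - |s - t|)/2, in which the terms |s|
and |t| cancel. This is what makes that covariance the one of a noise with intensity du. -/
lemma volume_real_Ioc_inter_Ioc {a b c d : ℝ} (hab : a ≤ b) (hcd : c ≤ d) :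
    volume.real (Set.Ioc a b ∩ Set.Ioc c d) =
      (|a - d| + |b - c| - |b - d| - |a - c|) / 2 := by
  rw [Set.Ioc_inter_Ioc, measureReal_def, Real.volume_Ioc, ENNReal.toReal_ofReal']
  rcases abs_cases (a - d) with ⟨h1, _⟩ | ⟨h1, _⟩ <;>
  rcases abs_cases (b - c) with ⟨h2, _⟩ | ⟨h2, _⟩ <;>
  rcases abs_cases (b - d) with ⟨h3, _⟩ | ⟨h3, _⟩ <;>
  rcases abs_cases (a - c) with ⟨h4, _⟩ | ⟨h4, _⟩ <;>
  rw [h1, h2, h3, h4] <;> grind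

namespace IsOrthogonalNoise

variable {Z : ℝ → Ω → Vec n 𝕜}

lemma memLp_sub (hZ : IsOrthogonalNoise Z P) (a b : ℝ) (k : Fin n) :
    MemLp (fun ω ↦ (Z b ω - Z a ω) k) 2 P :=
  (hZ.memLp b k).sub (hZ.memLp a k)

lemma integral_increment_mul_star (hZ : IsOrthogonalNoise Z P) {a b c d : ℝ} (hab : a ≤ b)
    (hcd : c ≤ d) (k l : Fin n) :
    ∫ ω, (Z b ω - Z a ω) k * star ((Z d ω - Z c ω) l) ∂P =
      if k = l then (volume.real (Set.Ioc a b ∩ Set.Ioc c d) : 𝕜) else 0 := by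
  have hi (s t : ℝ) : Integrable (fun ω ↦ Z s ω k * star (Z t ω l)) P :=
    integrable_mul_star (hZ.memLp s k) (hZ.memLp t l)
  have h := integral_sub ((hi b d).sub (hi a d)) ((hi b c).sub (hi a c))
  simp only [Pi.sub_apply] at h
  have h' : ∫ ω, (Z b ω - Z a ω) k * star ((Z d ω - Z c ω) l) ∂P =
      ∫ ω, Z b ω k * star (Z d ω l) - Z a ω k * star (Z d ω l) -
        (Z b ω k * star (Z c ω l) - Z a ω k * star (Z c ω l)) ∂P := by
    congr 1 with ω
    simp only [PiLp.sub_apply, star_sub]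
    ring
  rw [h', h, integral_sub (hi _ _) (hi _ _), integral_sub (hi _ _) (hi _ _)]
  simp only [hZ.integral_mul_star, volume_real_Ioc_inter_Ioc hab hcd]
  split_ifs
  · push_cast
    ring
  · simp

end IsOrthogonalNoise

namespace StepFunction

lemma memLp_toFun (φ : StepFunction n 𝕜) (i k : Fin n) :
    MemLp (fun u ↦ φ.toFun u i k) 2 volume := by
  simp only [toFun, Matrix.sum_apply]
  refine memLp_finsetSum _ fun p _ ↦ ?_
  have : (fun u ↦ (Set.Ioc (φ.left p) (φ.right p)).indicator (fun _ ↦ φ.coeff p) u i k) =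
      (Set.Ioc (φ.left p) (φ.right p)).indicator (fun _ ↦ φ.coeff p i k) := by
    ext u
    by_cases hu : u ∈ Set.Ioc (φ.left p) (φ.right p) <;> simp [hu]
  rw [this]
  exact memLp_indicator_const 2 measurableSet_Ioc _ (Or.inr (by simp))

omit [MeasurableSpace Ω] in
lemma integral_apply (φ : StepFunction n 𝕜) (Z : ℝ → Ω → Vec n 𝕜) (ω : Ω) (i : Fin n) :
    φ.integral Z ω i =
      ∑ p, ∑ k, φ.coeff p i k * (Z (φ.right p) ω - Z (φ.left p) ω) k := by
  simp [integral, act, Matrix.mulVec, dotProduct]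

lemma memLp_integral (φ : StepFunction n 𝕜) {Z : ℝ → Ω → Vec n 𝕜}
    (hZ : IsOrthogonalNoise Z P) (i : Fin n) : MemLp (fun ω ↦ φ.integral Z ω i) 2 P := by
  simp only [integral_apply]
  exact memLp_finsetSum _ fun p _ ↦ memLp_finsetSum _ fun k _ ↦
    (hZ.memLp_sub _ _ k).const_mul _

lemma toFun_apply (φ : StepFunction n 𝕜) (u : ℝ) (i k : Fin n) :
    φ.toFun u i k =
      ∑ p, φ.coeff p i k * (Set.Ioc (φ.left p) (φ.right p)).indicator (fun _ ↦ (1 : 𝕜)) u := by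
  simp only [toFun, Matrix.sum_apply]
  refine Finset.sum_congr rfl fun p _ ↦ ?_
  by_cases hu : u ∈ Set.Ioc (φ.left p) (φ.right p) <;> simp [hu]

lemma integral_indicator_mul_star {a b c d : ℝ} :
    ∫ u, (Set.Ioc a b).indicator (fun _ ↦ (1 : 𝕜)) u *
      star ((Set.Ioc c d).indicator (fun _ ↦ (1 : 𝕜)) u) =
      (volume.real (Set.Ioc a b ∩ Set.Ioc c d) : 𝕜) := by
  have : (fun u ↦ (Set.Ioc a b).indicator (fun _ ↦ (1 : 𝕜)) u *
      star ((Set.Ioc c d).indicator (fun _ ↦ (1 : 𝕜)) u)) =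
      (Set.Ioc a b ∩ Set.Ioc c d).indicator (fun _ ↦ (1 : 𝕜)) := by
    ext u
    by_cases h1 : u ∈ Set.Ioc a b <;> by_cases h2 : u ∈ Set.Ioc c d <;>
      simp only [Set.indicator, Set.mem_inter_iff, h1, h2] <;> simp
  rw [this, integral_indicator (measurableSet_Ioc.inter measurableSet_Ioc), setIntegral_const]
  simp [RCLike.real_smul_eq_coe_mul]

/-- The Itô isometry for step functions. -/
lemma integral_mul_star_integral (φ ψ : StepFunction n 𝕜) {Z : ℝ → Ω → Vec n 𝕜}
    (hZ : IsOrthogonalNoise Z P) (i j : Fin n) :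
    ∫ ω, φ.integral Z ω i * star (ψ.integral Z ω j) ∂P =
      ∑ k, ∫ u, φ.toFun u i k * star (ψ.toFun u j k) := by
  have hL : ∫ ω, φ.integral Z ω i * star (ψ.integral Z ω j) ∂P =
      ∑ p, ∑ k, ∑ q, ∑ l, φ.coeff p i k * star (ψ.coeff q j l) *
        ∫ ω, (Z (φ.right p) ω - Z (φ.left p) ω) k *
          star ((Z (ψ.right q) ω - Z (ψ.left q) ω) l) ∂P := by
    have hint (p k q l) := (integrable_mul_star (hZ.memLp_sub (φ.left p) (φ.right p) k)
      (hZ.memLp_sub (ψ.left q) (ψ.right q) l)).const_mul (φ.coeff p i k * star (ψ.coeff q j l))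
    have e : (fun ω ↦ φ.integral Z ω i * star (ψ.integral Z ω j)) = fun ω ↦
        ∑ p, ∑ k, ∑ q, ∑ l, φ.coeff p i k * star (ψ.coeff q j l) *
          ((Z (φ.right p) ω - Z (φ.left p) ω) k *
          star ((Z (ψ.right q) ω - Z (ψ.left q) ω) l)) := by
      ext ω
      simp only [integral_apply, star_sum, star_mul', Finset.sum_mul]
      simp only [Finset.mul_sum]
      refine Finset.sum_congr rfl fun p _ ↦ Finset.sum_congr rfl fun k _ ↦
        Finset.sum_congr rfl fun q _ ↦ Finset.sum_congr rfl fun l _ ↦ by ring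
    rw [e, integral_finsetSum _ fun p _ ↦ integrable_finsetSum _ fun k _ ↦
      integrable_finsetSum _ fun q _ ↦ integrable_finsetSum _ fun l _ ↦ hint p k q l]
    refine Finset.sum_congr rfl fun p _ ↦ ?_
    rw [integral_finsetSum _ fun k _ ↦
      integrable_finsetSum _ fun q _ ↦ integrable_finsetSum _ fun l _ ↦ hint p k q l]
    refine Finset.sum_congr rfl fun k _ ↦ ?_
    rw [integral_finsetSum _ fun q _ ↦ integrable_finsetSum _ fun l _ ↦ hint p k q l]
    refine Finset.sum_congr rfl fun q _ ↦ ?_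
    rw [integral_finsetSum _ fun l _ ↦ hint p k q l]
    exact Finset.sum_congr rfl fun l _ ↦ integral_const_mul _ _
  have hR (k : Fin n) : ∫ u, φ.toFun u i k * star (ψ.toFun u j k) =
      ∑ p, ∑ q, φ.coeff p i k * star (ψ.coeff q j k) *
        (volume.real (Set.Ioc (φ.left p) (φ.right p) ∩ Set.Ioc (ψ.left q) (ψ.right q)) : 𝕜) := by
    have hind (a b : ℝ) : MemLp ((Set.Ioc a b).indicator (fun _ ↦ (1 : 𝕜))) 2 volume :=
      memLp_indicator_const 2 measurableSet_Ioc _ (Or.inr (by simp))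
    have hint (p q) := (integrable_mul_star (hind (φ.left p) (φ.right p))
      (hind (ψ.left q) (ψ.right q))).const_mul (φ.coeff p i k * star (ψ.coeff q j k))
    have e : (fun u ↦ φ.toFun u i k * star (ψ.toFun u j k)) = fun u ↦
        ∑ p, ∑ q, φ.coeff p i k * star (ψ.coeff q j k) *
          ((Set.Ioc (φ.left p) (φ.right p)).indicator (fun _ ↦ (1 : 𝕜)) u *
          star ((Set.Ioc (ψ.left q) (ψ.right q)).indicator (fun _ ↦ (1 : 𝕜)) u)) := by
      ext u
      simp only [toFun_apply, star_sum, star_mul', Finset.sum_mul, Finset.mul_sum]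
      rw [Finset.sum_comm]
      refine Finset.sum_congr rfl fun p _ ↦ Finset.sum_congr rfl fun q _ ↦ by ring
    rw [e, integral_finsetSum _ fun p _ ↦ integrable_finsetSum _ fun q _ ↦ hint p q]
    refine Finset.sum_congr rfl fun p _ ↦ ?_
    rw [integral_finsetSum _ fun q _ ↦ hint p q]
    refine Finset.sum_congr rfl fun q _ ↦ ?_
    rw [integral_const_mul, integral_indicator_mul_star]
  rw [hL]
  simp_rw [hR, hZ.integral_increment_mul_star (φ.left_le_right _) (ψ.left_le_right _)]
  simp only [mul_ite, mul_zero, Finset.sum_ite_eq, Finset.mem_univ, if_true]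
  rw [Finset.sum_comm]

end StepFunction

/-- The Itô isometry. -/
lemma IsStochasticIntegral.integral_mul_star {Z : ℝ → Ω → Vec n 𝕜} (hZ : IsOrthogonalNoise Z P)
    {f g : ℝ → Mat n 𝕜} {Y W : Ω → Vec n 𝕜} (hY : IsStochasticIntegral Z P f Y)
    (hW : IsStochasticIntegral Z P g W) (i j : Fin n) :
    ∫ ω, Y ω i * star (W ω j) ∂P = ∑ k, ∫ u, f u i k * star (g u j k) := by
  have hcomp {U : Ω → Vec n 𝕜} (φ : ℕ → StepFunction n 𝕜)
      (h : Tendsto (fun m ↦ eLpNorm (fun ω ↦ (φ m).integral Z ω - U ω) 2 P) atTop (𝓝 0))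
      (i : Fin n) :
      Tendsto (fun m ↦ eLpNorm (fun ω ↦ (φ m).integral Z ω i - U ω i) 2 P) atTop (𝓝 0) :=
    tendsto_of_tendsto_of_tendsto_of_le_of_le tendsto_const_nhds h (fun _ ↦ zero_le)
      fun m ↦ eLpNorm_mono fun ω ↦ PiLp.norm_apply_le ((φ m).integral Z ω - U ω) i
  obtain ⟨hf, hYm, φ, hφ, hφY⟩ := hY
  obtain ⟨hg, hWm, ψ, hψ, hψW⟩ := hW
  have h1 := tendsto_integral_mul_star (fun m ↦ (φ m).memLp_integral hZ i)
    (fun m ↦ (ψ m).memLp_integral hZ j) (hYm.eval_piLp i) (hWm.eval_piLp j)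
    (hcomp φ hφY i) (hcomp ψ hψW j)
  have h2 := tendsto_finsetSum Finset.univ fun k _ ↦
    tendsto_integral_mul_star (fun m ↦ (φ m).memLp_toFun i k)
      (fun m ↦ (ψ m).memLp_toFun j k) (hf i k) (hg j k) (hφ i k) (hψ j k)
  simp_rw [StepFunction.integral_mul_star_integral _ _ hZ] at h1
  exact tendsto_nhds_unique h1 h2

end OFBM

end

/-! ### Both driving noises are orthogonal -/

noncomputable section

namespace OFBM

variable {n : ℕ} {Ω : Type*} [MeasurableSpace Ω] {P : Measure Ω}

section Brownian

variable {W : ℝ≥0 → Ω → ℝ}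

lemma memLp_two_brownian (hW : IsPreBrownianReal W P) (t : ℝ≥0) : MemLp (W t) 2 P :=
  (hW.isGaussianProcess.hasGaussianLaw_eval t).memLp_two

lemma integral_brownian_mul (hW : IsPreBrownianReal W P) (s t : ℝ≥0) :
    ∫ ω, W s ω * W t ω ∂P = min (s : ℝ) t := by
  have h := hW.covariance_eval s t
  rw [covariance] at h
  simpa [hW.integral_eval] using h

end Brownian

lemma integral_mul_eq_zero_of_indepFun {U V : Ω → ℝ} (h : IndepFun U V P)
    (hU : AEStronglyMeasurable U P) (hV : AEStronglyMeasurable V P) (h0 : ∫ ω, U ω ∂P = 0) :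
    ∫ ω, U ω * V ω ∂P = 0 := by
  rw [h.integral_fun_mul_eq_mul_integral hU hV, h0, zero_mul]

namespace IsTwoSidedBrownian

variable {B : ℝ → Ω → ℝ}

lemma memLp_two (hB : IsTwoSidedBrownian B P) (t : ℝ) : MemLp (B t) 2 P := by
  rcases le_total 0 t with h | h
  · simpa [Real.coe_toNNReal _ h] using
      memLp_two_brownian hB.forward.toIsPreBrownianReal t.toNNReal
  · simpa [Real.coe_toNNReal _ (neg_nonneg.2 h)] using
      memLp_two_brownian hB.backward.toIsPreBrownianReal (-t).toNNReal

lemma integral_eq_zero (hB : IsTwoSidedBrownian B P) (t : ℝ) : ∫ ω, B t ω ∂P = 0 := by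
  rcases le_total 0 t with h | h
  · simpa [Real.coe_toNNReal _ h] using hB.forward.integral_eval t.toNNReal
  · simpa [Real.coe_toNNReal _ (neg_nonneg.2 h)] using hB.backward.integral_eval (-t).toNNReal

lemma integral_mul_of_nonneg_of_nonpos (hB : IsTwoSidedBrownian B P) {s t : ℝ} (hs : 0 ≤ s)
    (ht : t ≤ 0) : ∫ ω, B s ω * B t ω ∂P = 0 := by
  refine integral_mul_eq_zero_of_indepFun ?_ (hB.memLp_two s).aestronglyMeasurable
    (hB.memLp_two t).aestronglyMeasurable (hB.integral_eq_zero s)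
  have h := hB.indep.comp (measurable_pi_apply s.toNNReal) (measurable_pi_apply (-t).toNNReal)
  simpa [Function.comp_def, Real.coe_toNNReal _ hs, Real.coe_toNNReal _ (neg_nonneg.2 ht)] using h

/-- The formula equals min(|s|, |t|) for times of the same sign and 0 for opposite signs, where the
two half-line motions are independent. -/
lemma integral_mul (hB : IsTwoSidedBrownian B P) (s t : ℝ) :
    ∫ ω, B s ω * B t ω ∂P = (|s| + |t| - |s - t|) / 2 := by
  rcases le_total 0 s with hs | hs <;> rcases le_total 0 t with ht | ht
  · have h := integral_brownian_mul hB.forward.toIsPreBrownianReal s.toNNReal t.toNNReal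
    simp only [Real.coe_toNNReal _ hs, Real.coe_toNNReal _ ht] at h
    rw [h, abs_of_nonneg hs, abs_of_nonneg ht]
    grind
  · rw [hB.integral_mul_of_nonneg_of_nonpos hs ht, abs_of_nonneg hs, abs_of_nonpos ht,
      abs_of_nonneg (by linarith)]
    ring
  · simp_rw [mul_comm (B s _)]
    rw [hB.integral_mul_of_nonneg_of_nonpos ht hs, abs_of_nonneg ht, abs_of_nonpos hs,
      abs_of_nonpos (by linarith)]
    ring
  · have h := integral_brownian_mul hB.backward.toIsPreBrownianReal (-s).toNNReal (-t).toNNReal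
    simp only [Real.coe_toNNReal _ (neg_nonneg.2 hs), Real.coe_toNNReal _ (neg_nonneg.2 ht),
      neg_neg] at h
    rw [h, abs_of_nonpos hs, abs_of_nonpos ht]
    grind

end IsTwoSidedBrownian

lemma IsVectorBrownian.isOrthogonalNoise {B : ℝ → Ω → Vec n ℝ} (hB : IsVectorBrownian B P) :
    IsOrthogonalNoise B P where
  memLp t k := (hB.brownian k).memLp_two t
  integral_mul_star s t k l := by
    simp only [star_trivial]
    split_ifs with h
    · subst h
      simpa using (hB.brownian k).integral_mul s t
    · exact integral_mul_eq_zero_of_indepFun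
        ((hB.indep.indepFun h).comp (measurable_pi_apply s) (measurable_pi_apply t))
        ((hB.brownian k).memLp_two s).aestronglyMeasurable
        ((hB.brownian l).memLp_two t).aestronglyMeasurable ((hB.brownian k).integral_eq_zero s)

namespace IsHermitianNoise

section HalfBrownian

variable {W : ℝ → Ω → ℝ} (hW : IsBrownianReal (fun (x : ℝ≥0) ω ↦ √2 * W x ω) P)

include hW

lemma memLp_two_of_nonneg {t : ℝ} (ht : 0 ≤ t) : MemLp (W t) 2 P := by
  have h := (memLp_two_brownian hW.toIsPreBrownianReal t.toNNReal).const_mul (√2)⁻¹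
  simpa [Real.coe_toNNReal _ ht, ← mul_assoc] using h

lemma integral_of_nonneg {t : ℝ} (ht : 0 ≤ t) : ∫ ω, W t ω ∂P = 0 := by
  have h := hW.integral_eval t.toNNReal
  simpa [Real.coe_toNNReal _ ht, integral_const_mul] using h

lemma integral_mul_of_nonneg {s t : ℝ} (hs : 0 ≤ s) (ht : 0 ≤ t) :
    ∫ ω, W s ω * W t ω ∂P = min s t / 2 := by
  have h := integral_brownian_mul hW.toIsPreBrownianReal s.toNNReal t.toNNReal
  simp only [Real.coe_toNNReal _ hs, Real.coe_toNNReal _ ht] at h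
  rw [← h, eq_div_iff two_ne_zero, ← integral_mul_const]
  congr 1 with ω
  linear_combination (-(W s ω * W t ω)) * Real.mul_self_sqrt zero_le_two

lemma ae_eq_zero : ∀ᵐ ω ∂P, W 0 ω = 0 := by
  filter_upwards [hW.eval_zero_ae_eq_zero] with ω hω
  simpa using hω

end HalfBrownian

variable {B₁ B₂ : ℝ → Ω → Vec n ℝ} (hB : IsHermitianNoise B₁ B₂ P)

include hB

/-- An even measure has an odd distribution function, once it is known to vanish at 0. -/
lemma ae_eq_abs₁ (t : ℝ) (k : Fin n) :
    (fun ω ↦ B₁ t ω k) =ᵐ[P] fun ω ↦ (if t < 0 then -1 else 1) * B₁ |t| ω k := by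
  split_ifs with ht
  · filter_upwards [hB.even₁ 0 |t|, ae_eq_zero (W := fun x ω ↦ B₁ x ω k) (hB.brownian₁ k)] with ω h h0
    have := congr_arg (fun v : Vec n ℝ ↦ v k) h
    simp only [abs_of_neg ht, neg_zero, neg_neg, PiLp.sub_apply, h0] at this ⊢
    linarith
  · simp [abs_of_nonneg (not_lt.1 ht)]

/-- An odd measure has an even distribution function, whatever its value at 0. -/
lemma ae_eq_abs₂ (t : ℝ) (k : Fin n) : (fun ω ↦ B₂ t ω k) =ᵐ[P] fun ω ↦ B₂ |t| ω k := by
  rcases lt_or_ge t 0 with ht | ht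
  · filter_upwards [hB.odd₂ 0 |t|] with ω h
    have := congr_arg (fun v : Vec n ℝ ↦ v k) h
    simp only [abs_of_neg ht, neg_zero, neg_neg, PiLp.sub_apply, PiLp.neg_apply] at this ⊢
    linarith
  · simp [abs_of_nonneg ht]

lemma memLp_two₁ (t : ℝ) (k : Fin n) : MemLp (fun ω ↦ B₁ t ω k) 2 P :=
  ((memLp_two_of_nonneg (W := fun x ω ↦ B₁ x ω k) (hB.brownian₁ k) (abs_nonneg t)).const_mul _).ae_eq
    (hB.ae_eq_abs₁ t k).symm

lemma memLp_two₂ (t : ℝ) (k : Fin n) : MemLp (fun ω ↦ B₂ t ω k) 2 P :=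
  (memLp_two_of_nonneg (W := fun x ω ↦ B₂ x ω k) (hB.brownian₂ k) (abs_nonneg t)).ae_eq (hB.ae_eq_abs₂ t k).symm

lemma integral_apply₁ (t : ℝ) (k : Fin n) : ∫ ω, B₁ t ω k ∂P = 0 := by
  rw [integral_congr_ae (hB.ae_eq_abs₁ t k), integral_const_mul,
    integral_of_nonneg (W := fun x ω ↦ B₁ x ω k) (hB.brownian₁ k) (abs_nonneg t), mul_zero]

lemma integral_apply₂ (t : ℝ) (k : Fin n) : ∫ ω, B₂ t ω k ∂P = 0 := by
  rw [integral_congr_ae (hB.ae_eq_abs₂ t k), integral_of_nonneg (W := fun x ω ↦ B₂ x ω k) (hB.brownian₂ k) (abs_nonneg t)]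

lemma integral_mul₁ (s t : ℝ) (k l : Fin n) : ∫ ω, B₁ s ω k * B₁ t ω l ∂P =
    if k = l then (if s < 0 then -1 else 1) * (if t < 0 then -1 else 1) * (min |s| |t| / 2)
    else 0 := by
  rcases eq_or_ne k l with rfl | h
  · rw [if_pos rfl]
    rw [← integral_mul_of_nonneg (W := fun x ω ↦ B₁ x ω k) (hB.brownian₁ k) (abs_nonneg s) (abs_nonneg t),
      ← integral_const_mul]
    refine integral_congr_ae ?_
    filter_upwards [hB.ae_eq_abs₁ s k, hB.ae_eq_abs₁ t k] with ω h1 h2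
    rw [h1, h2]
    ring
  rw [if_neg h]
  exact integral_mul_eq_zero_of_indepFun
    ((hB.indep₁.indepFun h).comp (measurable_pi_apply s) (measurable_pi_apply t))
    (hB.memLp_two₁ s k).aestronglyMeasurable (hB.memLp_two₁ t l).aestronglyMeasurable
    (hB.integral_apply₁ s k)

lemma integral_mul₂ (s t : ℝ) (k l : Fin n) : ∫ ω, B₂ s ω k * B₂ t ω l ∂P =
    if k = l then min |s| |t| / 2 else 0 := by
  split_ifs with h
  · subst h
    rw [← integral_mul_of_nonneg (W := fun x ω ↦ B₂ x ω k) (hB.brownian₂ k) (abs_nonneg s) (abs_nonneg t)]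
    refine integral_congr_ae ?_
    filter_upwards [hB.ae_eq_abs₂ s k, hB.ae_eq_abs₂ t k] with ω h1 h2
    rw [h1, h2]
  · exact integral_mul_eq_zero_of_indepFun
      ((hB.indep₂.indepFun h).comp (measurable_pi_apply s) (measurable_pi_apply t))
      (hB.memLp_two₂ s k).aestronglyMeasurable (hB.memLp_two₂ t l).aestronglyMeasurable
      (hB.integral_apply₂ s k)

lemma integral_mul₁₂ (s t : ℝ) (k l : Fin n) : ∫ ω, B₁ s ω k * B₂ t ω l ∂P = 0 :=
  integral_mul_eq_zero_of_indepFun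
    (hB.indep.comp (φ := fun x : ℝ → Vec n ℝ ↦ x s k) (ψ := fun x : ℝ → Vec n ℝ ↦ x t l)
      (by fun_prop) (by fun_prop))
    (hB.memLp_two₁ s k).aestronglyMeasurable (hB.memLp_two₂ t l).aestronglyMeasurable
    (hB.integral_apply₁ s k)

lemma integral_complexProcess_mul_star (s t : ℝ) (k l : Fin n) :
    ∫ ω, complexProcess B₁ B₂ s ω k * star (complexProcess B₁ B₂ t ω l) ∂P =
      ((∫ ω, B₁ s ω k * B₁ t ω l ∂P + ∫ ω, B₂ s ω k * B₂ t ω l ∂P : ℝ) : ℂ) := by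
  have h11 := (hB.memLp_two₁ s k).integrable_mul (hB.memLp_two₁ t l)
  have h22 := (hB.memLp_two₂ s k).integrable_mul (hB.memLp_two₂ t l)
  have h12 := (hB.memLp_two₁ s k).integrable_mul (hB.memLp_two₂ t l)
  have h21 := (hB.memLp_two₁ t l).integrable_mul (hB.memLp_two₂ s k)
  have e : (fun ω ↦ complexProcess B₁ B₂ s ω k * star (complexProcess B₁ B₂ t ω l)) =
      fun ω ↦ ((B₁ s ω k * B₁ t ω l + B₂ s ω k * B₂ t ω l : ℝ) : ℂ) +
        Complex.I * ((B₁ t ω l * B₂ s ω k - B₁ s ω k * B₂ t ω l : ℝ) : ℂ) := by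
    ext ω
    simp only [complexProcess, star_add, star_mul', RCLike.star_def, Complex.conj_I,
      Complex.conj_ofReal]
    push_cast
    linear_combination -((B₂ s ω k : ℂ) * B₂ t ω l) * Complex.I_mul_I
  have i1 : Integrable (fun ω ↦ ((B₁ s ω k * B₁ t ω l + B₂ s ω k * B₂ t ω l : ℝ) : ℂ)) P :=
    (h11.add h22).ofReal
  have i2 : Integrable (fun ω ↦ Complex.I *
      ((B₁ t ω l * B₂ s ω k - B₁ s ω k * B₂ t ω l : ℝ) : ℂ)) P :=
    ((h21.sub h12).ofReal (𝕜 := ℂ)).const_mul Complex.I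
  have j1 := integral_add h11 h22
  have j2 := integral_sub h21 h12
  simp only [Pi.mul_apply] at j1 j2
  rw [e, integral_add i1 i2, integral_const_mul, integral_complex_ofReal,
    integral_complex_ofReal, j1, j2, hB.integral_mul₁₂, hB.integral_mul₁₂,
    sub_self, Complex.ofReal_zero, mul_zero, add_zero]

lemma isOrthogonalNoise : IsOrthogonalNoise (complexProcess B₁ B₂) P where
  memLp t k := by
    have h1 : MemLp (fun ω ↦ (B₁ t ω k : ℂ)) 2 P := (hB.memLp_two₁ t k).ofReal
    have h2 : MemLp (fun ω ↦ (B₂ t ω k : ℂ)) 2 P := (hB.memLp_two₂ t k).ofReal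
    exact h1.add (h2.const_mul Complex.I)
  integral_mul_star s t k l := by
    rw [hB.integral_complexProcess_mul_star, hB.integral_mul₁, hB.integral_mul₂]
    by_cases h : k = l
    -- For times of opposite sign the contributions of `B₁` and `B₂` cancel, and for the same sign
    -- they add up to min(|s|, |t|). Thus the reflected halves are orthogonal although `B₁` and `B₂`
    -- are each determined by one half-line.
    · have key : (if s < 0 then -1 else 1) * (if t < 0 then -1 else 1) * (min |s| |t| / 2) +
          min |s| |t| / 2 = (|s| + |t| - |s - t|) / 2 := by
        rcases abs_cases s with ⟨h1, hs⟩ | ⟨h1, hs⟩ <;>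
        rcases abs_cases t with ⟨h2, ht⟩ | ⟨h2, ht⟩ <;>
        simp only [h1, h2, hs, ht, not_lt.2, if_true, if_false] <;> grind
      simp only [if_pos h, key]
      rfl
    · simp [h]

end IsHermitianNoise

end OFBM

end

/-! ### Antisymmetric moments in the time domain -/

noncomputable section

namespace OFBM

variable {n : ℕ} {Ω : Type u} [MeasurableSpace Ω] {P : Measure Ω}

/-- The antisymmetric pairing of the two scalar kernels of the time domain representation. -/
def timePairing (s t : ℝ) : ℝ :=
  ∫ u : ℝ, (Real.sign (s - u) - Real.sign (-u)) * Real.log (|t - u| / |u|) -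
    (Real.sign (t - u) - Real.sign (-u)) * Real.log (|s - u| / |u|)

/-- In the product of two kernels, the MM* and NN* terms are symmetric in s and t and cancel. Only
the mixed sign-logarithm terms survive. -/
lemma HasTimeRepresentation.secondMoment_sub_swap {X : ℝ → Ω → Vec n ℝ} {M N : Mat n ℝ}
    (h : HasTimeRepresentation.{u, v} X P M N) (i j : Fin n) (s t : ℝ) :
    secondMoment X P i j s t - secondMoment X P i j t s =
      timePairing s t * (M * Nᵀ - N * Mᵀ) i j := by
  obtain ⟨Ω', _, P', _, B, Y, hB, hY, hXY⟩ := h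
  have hiso (s t : ℝ) : secondMoment Y P' i j s t =
      ∑ k, ∫ u, timeKernel M N s u i k * timeKernel M N t u j k := by
    simpa using! (hY s).integral_mul_star hB.isOrthogonalNoise (hY t) i j
  have hint (s t : ℝ) (k : Fin n) :
      Integrable (fun u ↦ timeKernel M N s u i k * timeKernel M N t u j k) :=
    ((hY s).1 i k).integrable_mul ((hY t).1 j k)
  rw [hXY.secondMoment_eq, hXY.secondMoment_eq, hiso, hiso, ← Finset.sum_sub_distrib]
  simp only [Matrix.sub_apply, Matrix.mul_apply, Matrix.transpose_apply,
    ← Finset.sum_sub_distrib, Finset.mul_sum]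
  refine Finset.sum_congr rfl fun k _ ↦ ?_
  rw [← integral_sub (hint _ _ _) (hint _ _ _), timePairing, ← integral_mul_const]
  congr 1 with u
  simp only [timeKernel, Matrix.add_apply, Matrix.smul_apply, smul_eq_mul]
  ring

lemma sign_sub_sub_sign_neg {t u : ℝ} (ht : 0 < t) (h0 : u ≠ 0) (h1 : u ≠ t) :
    Real.sign (t - u) - Real.sign (-u) = (Set.Ioc 0 t).indicator (fun _ ↦ 2) u := by
  rcases h0.lt_or_gt with h0 | h0
  · rw [Real.sign_of_pos (by linarith), Real.sign_of_pos (by linarith),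
      Set.indicator_of_notMem (fun h ↦ h0.not_gt h.1), sub_self]
  · rcases h1.lt_or_gt with h1 | h1
    · rw [Real.sign_of_pos (by linarith), Real.sign_of_neg (by linarith),
        Set.indicator_of_mem (Set.mem_Ioc.2 ⟨h0, h1.le⟩)]
      norm_num
    · rw [Real.sign_of_neg (by linarith), Real.sign_of_neg (by linarith),
        Set.indicator_of_notMem (fun h ↦ h1.not_ge h.2), sub_self]

/-- Almost everywhere the sign differences are 2·1_(0,1] and 2·1_(0,2], which leaves integrals of
logarithms over bounded intervals. The two integrals are 4 log 2 and -4 log 2, and they are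
subtracted. -/
lemma timePairing_one_two : timePairing 1 2 = 8 * Real.log 2 := by
  have hae : (fun u : ℝ ↦ (Real.sign (1 - u) - Real.sign (-u)) * Real.log (|2 - u| / |u|) -
      (Real.sign (2 - u) - Real.sign (-u)) * Real.log (|1 - u| / |u|)) =ᵐ[volume]
      fun u ↦ (Set.Ioc (0 : ℝ) 1).indicator
          (fun u ↦ 2 * (Real.log (2 - u) - Real.log u)) u -
        (Set.Ioc (0 : ℝ) 2).indicator (fun u ↦ 2 * (Real.log (1 - u) - Real.log u)) u := by
    have hne (a : ℝ) : ∀ᵐ u : ℝ, u ≠ a := by simp [ae_iff]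
    filter_upwards [hne 0, hne 1, hne 2] with u h0 h1 h2
    rw [sign_sub_sub_sign_neg one_pos h0 h1, sign_sub_sub_sign_neg two_pos h0 h2,
      Real.log_div (abs_ne_zero.2 (sub_ne_zero.2 h2.symm)) (abs_ne_zero.2 h0),
      Real.log_div (abs_ne_zero.2 (sub_ne_zero.2 h1.symm)) (abs_ne_zero.2 h0)]
    simp only [Real.log_abs, Set.indicator_apply, ite_mul, zero_mul]
  have hlog (a b : ℝ) : IntervalIntegrable Real.log volume a b :=
    intervalIntegral.intervalIntegrable_log'
  have hlog' (a b t : ℝ) : IntervalIntegrable (fun u ↦ Real.log (t - u)) volume a b := by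
    simpa using (hlog (t - a) (t - b)).comp_sub_left t
  have hint (a t : ℝ) :
      IntervalIntegrable (fun u ↦ 2 * (Real.log (t - u) - Real.log u)) volume 0 a :=
    ((hlog' 0 a t).sub (hlog 0 a)).const_mul 2
  rw [timePairing, integral_congr_ae hae, integral_sub
      ((integrable_indicator_iff measurableSet_Ioc).2
        ((intervalIntegrable_iff_integrableOn_Ioc_of_le zero_le_one).1 (hint 1 2)))
      ((integrable_indicator_iff measurableSet_Ioc).2
        ((intervalIntegrable_iff_integrableOn_Ioc_of_le zero_le_two).1 (hint 2 1))),
    integral_indicator measurableSet_Ioc, integral_indicator measurableSet_Ioc,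
    ← intervalIntegral.integral_of_le zero_le_one, ← intervalIntegral.integral_of_le zero_le_two,
    intervalIntegral.integral_const_mul, intervalIntegral.integral_const_mul,
    intervalIntegral.integral_sub (hlog' _ _ _) (hlog _ _),
    intervalIntegral.integral_sub (hlog' _ _ _) (hlog _ _),
    intervalIntegral.integral_comp_sub_left Real.log,
    intervalIntegral.integral_comp_sub_left Real.log]
  simp only [integral_log]
  norm_num
  ring

end OFBM

end

/-! ### Antisymmetric moments in the spectral domain -/

noncomputable section

namespace OFBM

variable {n : ℕ} {Ω : Type u} [MeasurableSpace Ω] {P : Measure Ω}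

/-- The scalar kernel `(e^{itx} - 1) / (ix)` of the spectral domain representation. -/
def spectralFactor (t x : ℝ) : ℂ := (Complex.exp (Complex.I * t * x) - 1) / (Complex.I * x)

/-- The antisymmetric pairing of the scalar kernels of the spectral domain representation. -/
def spectralPairing (s t : ℝ) : ℝ :=
  ∫ x : ℝ, -2 * Real.sign x * (spectralFactor s x * star (spectralFactor t x)).im

/-- At exponent 1/2 the power D is 0, and the convention that `matPow` vanishes at base 0 turns the
two powers into the indicators of x > 0 and x < 0. -/
lemma spectralKernel_half_apply (A₁ A₂ : Mat n ℝ) {x : ℝ} (hx : x ≠ 0) (t : ℝ) (i k : Fin n) :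
    spectralKernel ((1 / 2 : ℝ) • (1 : Mat n ℝ))
      (A₁.map Complex.ofReal + Complex.I • A₂.map Complex.ofReal) t x i k =
      spectralFactor t x * (A₁ i k + Real.sign x * Complex.I * A₂ i k) := by
  rw [spectralKernel, sub_self, neg_zero, matPow_zero_exponent, matPow_zero_exponent]
  rcases hx.lt_or_gt with h | h
  · have h1 : max x 0 = 0 := max_eq_right h.le
    have h2 : max (-x) 0 ≠ 0 := by rw [max_eq_left (by linarith)]; linarith
    simp [h1, h2, Real.sign_of_neg h, spectralFactor, Matrix.map_one]
  · have h1 : max x 0 ≠ 0 := by rw [max_eq_left h.le]; exact hx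
    have h2 : max (-x) 0 = 0 := max_eq_right (by linarith)
    simp [h1, h2, Real.sign_of_pos h, spectralFactor, Matrix.map_one]

/-- Exchanging s and t conjugates the product w of the scalar factors. The terms in Re w therefore
cancel, and those in Im w double, with coefficient sign(x) times A₂A₁* - A₁A₂*. -/
lemma HasSpectralRepresentation.secondMoment_sub_swap {X : ℝ → Ω → Vec n ℝ} {A₁ A₂ : Mat n ℝ}
    (h : HasSpectralRepresentation.{u, w} X P ((1 / 2 : ℝ) • (1 : Mat n ℝ))
      (A₁.map Complex.ofReal + Complex.I • A₂.map Complex.ofReal)) (i j : Fin n) (s t : ℝ) :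
    secondMoment X P i j s t - secondMoment X P i j t s =
      spectralPairing s t * (A₂ * A₁ᵀ - A₁ * A₂ᵀ) i j := by
  obtain ⟨Ω', _, P', _, B₁, B₂, Y, hB, hY, hXY⟩ := h
  set A := A₁.map Complex.ofReal + Complex.I • A₂.map Complex.ofReal with hA
  set f := spectralKernel ((1 / 2 : ℝ) • (1 : Mat n ℝ)) A with hf
  have hiso (s t : ℝ) : (secondMoment X P i j s t : ℂ) =
      ∑ k, ∫ x, f s x i k * star (f t x j k) := by
    rw [← (hY s).integral_mul_star hB.isOrthogonalNoise (hY t) i j, secondMoment,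
      ← integral_complex_ofReal]
    have := ((hXY.identDistrib_prodMk s t).comp
      (u := fun p : Vec n ℂ × Vec n ℂ ↦ p.1 i * star (p.2 j)) (by fun_prop)).integral_eq
    simpa [toComplex, Function.comp_def] using! this
  have hint (s t : ℝ) (k : Fin n) : Integrable (fun x ↦ f s x i k * star (f t x j k)) :=
    integrable_mul_star ((hY s).1 i k) ((hY t).1 j k)
  -- The moments of X are real, so only the real parts of the integrands count.
  have hre (s t : ℝ) : secondMoment X P i j s t =
      ∑ k, ∫ x, (f s x i k * star (f t x j k)).re := by
    rw [← Complex.ofReal_re (secondMoment X P i j s t), hiso, Complex.re_sum]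
    exact Finset.sum_congr rfl fun k _ ↦ (integral_re (hint s t k)).symm
  have hint' (s t : ℝ) (k : Fin n) :
      Integrable (fun x ↦ (f s x i k * star (f t x j k)).re) := (hint s t k).re
  rw [hre, hre, ← Finset.sum_sub_distrib]
  simp only [Matrix.sub_apply, Matrix.mul_apply, Matrix.transpose_apply,
    ← Finset.sum_sub_distrib, Finset.mul_sum]
  refine Finset.sum_congr rfl fun k _ ↦ ?_
  rw [← integral_sub (hint' _ _ _) (hint' _ _ _), spectralPairing, ← integral_mul_const]
  refine integral_congr_ae ?_
  have hne : ∀ᵐ x : ℝ, x ≠ 0 := by simp [ae_iff]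
  filter_upwards [hne] with x hx
  simp only [hf, hA, spectralKernel_half_apply A₁ A₂ hx]
  simp only [RCLike.star_def, map_mul, map_add, Complex.conj_ofReal, Complex.conj_I,
    Complex.mul_re, Complex.mul_im, Complex.add_re, Complex.add_im, Complex.conj_re,
    Complex.conj_im, Complex.ofReal_re, Complex.ofReal_im, Complex.I_re, Complex.I_im,
    Complex.neg_re, Complex.neg_im]
  ring

/-! ### The spectral pairing does not vanish -/

lemma one_sub_cos_nonneg (x : ℝ) : 0 ≤ 1 - Real.cos x := sub_nonneg.2 (Real.cos_le_one x)

lemma one_sub_cos_le (x : ℝ) : 1 - Real.cos x ≤ x ^ 2 / 2 := by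
  linarith [Real.one_sub_sq_div_two_le_cos (x := x)]

lemma integrableOn_Ioi_of_le {f : ℝ → ℝ} (hf : ContinuousOn f (Set.Ioi 0))
    (h1 : ∀ x, 0 < x → x ≤ 1 → |f x| ≤ 1) (h2 : ∀ x, 1 ≤ x → |f x| ≤ 4 / x ^ 2) :
    IntegrableOn f (Set.Ioi 0) := by
  refine Integrable.mono' ((integrable_inv_one_add_sq.const_mul 8).integrableOn)
    (hf.aestronglyMeasurable measurableSet_Ioi) ?_
  refine (ae_restrict_iff' measurableSet_Ioi).2 (ae_of_all _ fun x (hx : 0 < x) ↦ ?_)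
  rw [Real.norm_eq_abs, ← div_eq_mul_inv]
  rcases le_total x 1 with h | h
  · refine (h1 x hx h).trans ((le_div_iff₀ (by positivity)).2 (by nlinarith))
  · refine (h2 x h).trans ((div_le_div_iff₀ (by positivity) (by positivity)).2 (by nlinarith))

lemma integrableOn_sin_mul_one_sub_cos_div_sq :
    IntegrableOn (fun x : ℝ ↦ Real.sin x * (1 - Real.cos x) / x ^ 2) (Set.Ioi 0) := by
  refine integrableOn_Ioi_of_le (ContinuousOn.div (by fun_prop) (by fun_prop)
    fun x hx ↦ pow_ne_zero 2 (ne_of_gt hx)) (fun x hx h ↦ ?_) fun x h ↦ ?_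
  · rw [abs_div, abs_mul, abs_of_nonneg (one_sub_cos_nonneg x), abs_of_nonneg (sq_nonneg x),
      div_le_one (by positivity)]
    nlinarith [Real.abs_sin_le_one x, one_sub_cos_le x, one_sub_cos_nonneg x]
  · rw [abs_div, abs_mul, abs_of_nonneg (one_sub_cos_nonneg x), abs_of_nonneg (sq_nonneg x)]
    gcongr
    nlinarith [Real.abs_sin_le_one x, Real.neg_one_le_cos x, one_sub_cos_nonneg x]

lemma integrableOn_one_sub_cos_sq_div_cube :
    IntegrableOn (fun x : ℝ ↦ (1 - Real.cos x) ^ 2 / x ^ 3) (Set.Ioi 0) := by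
  refine integrableOn_Ioi_of_le (ContinuousOn.div (by fun_prop) (by fun_prop)
    fun x hx ↦ pow_ne_zero 3 (ne_of_gt hx)) (fun x hx h ↦ ?_) fun x h ↦ ?_
  · rw [abs_of_nonneg (by positivity), div_le_one (by positivity)]
    calc (1 - Real.cos x) ^ 2 ≤ (x ^ 2 / 2) ^ 2 :=
          pow_le_pow_left₀ (one_sub_cos_nonneg x) (one_sub_cos_le x) 2
      _ = x ^ 3 * (x / 4) := by ring
      _ ≤ x ^ 3 * 1 := by gcongr; linarith
      _ = x ^ 3 := mul_one _
  · rw [abs_of_nonneg (by positivity)]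
    have h3 : x ^ 2 ≤ x ^ 3 := pow_le_pow_right₀ h (by norm_num)
    gcongr
    nlinarith [Real.neg_one_le_cos x, one_sub_cos_nonneg x]

/-- Integration by parts, since sin x (1 - cos x) is the derivative of (1 - cos x)²/2. It replaces
an integrand of varying sign by a nonnegative one. -/
lemma integral_sin_mul_one_sub_cos_div_sq :
    ∫ x in Set.Ioi (0 : ℝ), Real.sin x * (1 - Real.cos x) / x ^ 2 =
      ∫ x in Set.Ioi (0 : ℝ), (1 - Real.cos x) ^ 2 / x ^ 3 := by
  have hle (x : ℝ) : (1 - Real.cos x) ^ 2 / (2 * x ^ 2) ≤ x ^ 2 / 8 := by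
    rcases eq_or_ne x 0 with rfl | hx
    · simp
    · rw [div_le_iff₀ (by positivity)]
      calc (1 - Real.cos x) ^ 2 ≤ (x ^ 2 / 2) ^ 2 :=
            pow_le_pow_left₀ (one_sub_cos_nonneg x) (one_sub_cos_le x) 2
        _ = x ^ 2 / 8 * (2 * x ^ 2) := by ring
  -- At 0 the quotient is 0/0 = 0 by convention, which agrees with its limit, so the boundary term
  -- vanishes.
  have hcont : ContinuousWithinAt (fun x : ℝ ↦ (1 - Real.cos x) ^ 2 / (2 * x ^ 2))
      (Set.Ici 0) 0 := by
    refine ContinuousAt.continuousWithinAt ?_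
    have h8 : Tendsto (fun x : ℝ ↦ x ^ 2 / 8) (𝓝 0) (𝓝 0) := by
      have : Continuous fun x : ℝ ↦ x ^ 2 / 8 := by fun_prop
      simpa using this.tendsto 0
    simpa [ContinuousAt] using
      tendsto_of_tendsto_of_tendsto_of_le_of_le tendsto_const_nhds h8
        (fun x ↦ (by positivity : (0 : ℝ) ≤ (1 - Real.cos x) ^ 2 / (2 * x ^ 2))) hle
  have hlim : Tendsto (fun x : ℝ ↦ (1 - Real.cos x) ^ 2 / (2 * x ^ 2)) atTop (𝓝 0) := by
    have h2 : Tendsto (fun x : ℝ ↦ 2 / x ^ 2) atTop (𝓝 0) :=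
      tendsto_const_nhds.div_atTop (tendsto_pow_atTop two_ne_zero)
    refine squeeze_zero' (Eventually.of_forall fun x ↦ by positivity) ?_ h2
    filter_upwards [eventually_gt_atTop 0] with x hx
    rw [div_le_div_iff₀ (by positivity) (by positivity)]
    have : (1 - Real.cos x) ^ 2 ≤ 4 := by
      nlinarith [Real.neg_one_le_cos x, one_sub_cos_nonneg x]
    nlinarith [sq_nonneg x]
  have hderiv (x : ℝ) (hx : x ∈ Set.Ioi 0) :
      HasDerivAt (fun x : ℝ ↦ (1 - Real.cos x) ^ 2 / (2 * x ^ 2))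
        (Real.sin x * (1 - Real.cos x) / x ^ 2 - (1 - Real.cos x) ^ 2 / x ^ 3) x := by
    have hx0 : x ≠ 0 := ne_of_gt hx
    have h := (((Real.hasDerivAt_cos x).const_sub 1).pow 2).div
      (((hasDerivAt_id x).pow 2).const_mul 2) (by simpa using hx0)
    convert! h using 1
    simp only [Pi.pow_apply, id]
    field_simp
    push_cast
    ring
  have h := integral_Ioi_of_hasDerivAt_of_tendsto hcont hderiv
    (integrableOn_sin_mul_one_sub_cos_div_sq.sub integrableOn_one_sub_cos_sq_div_cube) hlim
  rw [integral_sub integrableOn_sin_mul_one_sub_cos_div_sq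
    integrableOn_one_sub_cos_sq_div_cube] at h
  simpa [sub_eq_zero] using h

lemma integral_one_sub_cos_sq_div_cube_pos :
    0 < ∫ x in Set.Ioi (0 : ℝ), (1 - Real.cos x) ^ 2 / x ^ 3 := by
  rw [setIntegral_pos_iff_support_of_nonneg_ae
    ((ae_restrict_iff' measurableSet_Ioi).2 (ae_of_all _ fun x (hx : 0 < x) ↦ by
      simp only [Pi.zero_apply]; positivity)) integrableOn_one_sub_cos_sq_div_cube]
  -- On (0,1) the sine is positive, hence cos x ≠ 1 and the integrand is nonzero.
  refine lt_of_lt_of_le ?_ (measure_mono (s := Set.Ioo (0 : ℝ) 1) fun x hx ↦ ⟨?_, hx.1⟩)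
  · simp
  · have hsin : 0 < Real.sin x := Real.sin_pos_of_pos_of_le_one hx.1 hx.2.le
    have hcos : 1 - Real.cos x ≠ 0 := fun h ↦ by
      nlinarith [Real.sin_sq_add_cos_sq x]
    exact div_ne_zero (pow_ne_zero 2 hcos) (pow_ne_zero 3 hx.1.ne')

/-- The product of the factors is (e^{ix} - 1)(e^{-2ix} - 1)/x², whose numerator has imaginary part
sin 2x - 2 sin x = -2 sin x (1 - cos x). The sign makes the whole even, so the integral over ℝ is
twice the one over the half-line. -/
lemma spectralFactor_one_two (x : ℝ) :
    -2 * Real.sign x * (spectralFactor 1 x * star (spectralFactor 2 x)).im =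
      4 * (Real.sin |x| * (1 - Real.cos |x|) / |x| ^ 2) := by
  have hexp (t : ℝ) : Complex.exp (Complex.I * t * x) =
      (Real.cos (t * x) : ℂ) + (Real.sin (t * x) : ℂ) * Complex.I := by
    rw [show Complex.I * t * x = ((t * x : ℝ) : ℂ) * Complex.I by push_cast; ring,
      Complex.exp_mul_I, Complex.ofReal_cos, Complex.ofReal_sin]
  have hfac : (spectralFactor 1 x * star (spectralFactor 2 x)).im =
      -2 * (Real.sin x * (1 - Real.cos x) / x ^ 2) := by
    have : spectralFactor 1 x * star (spectralFactor 2 x) =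
        ((((Real.cos x : ℂ) + (Real.sin x : ℂ) * Complex.I) - 1) *
        (((Real.cos (2 * x) : ℂ) - (Real.sin (2 * x) : ℂ) * Complex.I) - 1)) /
          ((x ^ 2 : ℝ) : ℂ) := by
      rw [spectralFactor, spectralFactor, hexp, hexp, one_mul, RCLike.star_def]
      simp only [map_div₀, map_sub, map_add, map_mul, map_one, Complex.conj_ofReal,
        Complex.conj_I]
      rw [div_mul_div_comm]
      congr 1
      · ring
      · push_cast
        linear_combination (-(x : ℂ) ^ 2) * Complex.I_mul_I
    rw [this, Complex.div_ofReal_im, mul_div_assoc', Real.cos_two_mul, Real.sin_two_mul]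
    congr 1
    simp only [Complex.mul_im, Complex.sub_re, Complex.sub_im, Complex.add_re, Complex.add_im,
      Complex.mul_re, Complex.ofReal_re, Complex.ofReal_im, Complex.I_re, Complex.I_im,
      Complex.one_re, Complex.one_im]
    ring
  rw [hfac]
  rcases lt_trichotomy x 0 with h | rfl | h
  · rw [Real.sign_of_neg h, abs_of_neg h, Real.sin_neg, Real.cos_neg]
    ring
  · simp
  · rw [Real.sign_of_pos h, abs_of_pos h]
    ring

lemma spectralPairing_one_two_pos : 0 < spectralPairing 1 2 := by
  simp only [spectralPairing, spectralFactor_one_two]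
  rw [integral_const_mul,
    integral_comp_abs (f := fun x ↦ Real.sin x * (1 - Real.cos x) / x ^ 2),
    integral_sin_mul_one_sub_cos_div_sq]
  linarith [integral_one_sub_cos_sq_div_cube_pos]

/-- If the antisymmetric part of the second moments is a multiple of a fixed matrix `K` and the
multiple at times `1, 2` does not vanish, then `X` is an OBM if and only if `K = 0`. -/
lemma IsOFBM.isOBM_iff [IsProbabilityMeasure P] {X : ℝ → Ω → Vec n ℝ}
    (hX : IsOFBM X ((1 / 2 : ℝ) • (1 : Mat n ℝ)) P) {c : ℝ → ℝ → ℝ} (hc : c 1 2 ≠ 0)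
    {K L : Mat n ℝ} (h : ∀ i j s t, secondMoment X P i j s t - secondMoment X P i j t s =
      c s t * (K - L) i j) : IsOBM X P ↔ K = L := by
  refine ⟨fun hB ↦ ?_, fun hKL ↦ hX.isOBM_of_secondMoment_swap fun i j s t ↦ ?_⟩
  · rw [← sub_eq_zero]
    ext i j
    have := h i j 1 2
    rw [hX.secondMoment_one_two_swap hB, sub_self] at this
    exact (mul_eq_zero.1 this.symm).resolve_left hc
  · rw [← sub_eq_zero, h, hKL, sub_self, Matrix.zero_apply, mul_zero]

end OFBM

end

theorem proposition7p1 {n : ℕ} {Ω : Type u} [MeasurableSpace Ω] (P : Measure Ω)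
    [IsProbabilityMeasure P] (X : ℝ → Ω → OFBM.Vec n ℝ) (hX : ∀ t, Measurable (X t))
    (hOFBM : OFBM.IsOFBM X ((1 / 2 : ℝ) • (1 : OFBM.Mat n ℝ)) P) :
    (∀ M N : OFBM.Mat n ℝ, OFBM.HasTimeRepresentation.{u, v} X P M N →
      (OFBM.IsOBM X P ↔ M * Nᵀ = N * Mᵀ)) ∧
    (∀ A₁ A₂ : OFBM.Mat n ℝ,
      OFBM.HasSpectralRepresentation.{u, w} X P ((1 / 2 : ℝ) • (1 : OFBM.Mat n ℝ))
        (A₁.map Complex.ofReal + Complex.I • A₂.map Complex.ofReal) →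
      (OFBM.IsOBM X P ↔ A₂ * A₁ᵀ = A₁ * A₂ᵀ)) ∧
    (∀ M N A₁ A₂ : OFBM.Mat n ℝ, OFBM.HasTimeRepresentation.{u, v} X P M N →
      OFBM.HasSpectralRepresentation.{u, w} X P ((1 / 2 : ℝ) • (1 : OFBM.Mat n ℝ))
        (A₁.map Complex.ofReal + Complex.I • A₂.map Complex.ofReal) →
      (M * Nᵀ = N * Mᵀ ↔ A₂ * A₁ᵀ = A₁ * A₂ᵀ)) := by
  have ha (M N : OFBM.Mat n ℝ) (h : OFBM.HasTimeRepresentation.{u, v} X P M N) :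
      OFBM.IsOBM X P ↔ M * Nᵀ = N * Mᵀ :=
    hOFBM.isOBM_iff (c := OFBM.timePairing)
      (by rw [OFBM.timePairing_one_two]; positivity) h.secondMoment_sub_swap
  have hb (A₁ A₂ : OFBM.Mat n ℝ)
      (h : OFBM.HasSpectralRepresentation.{u, w} X P ((1 / 2 : ℝ) • (1 : OFBM.Mat n ℝ))
        (A₁.map Complex.ofReal + Complex.I • A₂.map Complex.ofReal)) :
      OFBM.IsOBM X P ↔ A₂ * A₁ᵀ = A₁ * A₂ᵀ :=
    hOFBM.isOBM_iff (c := OFBM.spectralPairing) OFBM.spectralPairing_one_two_pos.ne'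
      h.secondMoment_sub_swap
  exact ⟨ha, hb, fun M N A₁ A₂ h h' ↦ (ha M N h).symm.trans (hb A₁ A₂ h')⟩
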